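/- \textbf{Setting.} Let $\mathcal I$ be a finite set of $I$ cells and let $\mathbf A$ be a $0$–$1$ matrix of full row rank, with columns indexed by $\mathcal I$ and at least one $1$ in every column. The relational model for probabilities generated by $\mathbf A$ is $$RM_{\boldsymbol p}(\mathbf A)=\Big\{\boldsymbol p\in\mathbb R_{>0}^{I}:\ \sum_{i}p_i=1,\ \log\boldsymbol p=\mathbf A'\boldsymbol\theta\ \text{for some }\boldsymbol\theta\Big\}.$$ Let $\mathbf D$ be a kernel basis matrix of $\mathbf A$, i.e. a real matrix whose rows form a basis of $\mathrm{Ker}(\mathbf A)$. Write $\Delta[\boldsymbol v]$ for the diagonal matrix with diagonal $\boldsymbol v$, $\boldsymbol 1$ for the vector of ones, $\mathbf I$ for the identity matrix. For a vector of counts $\boldsymbol y$, an MLE under $RM_{\boldsymbol p}(\mathbf A)$ is a point $\hat{\boldsymbol p}\in RM_{\boldsymbol p}(\mathbf A)$ that maximizes the multinomial likelihood of $\boldsymbol y$ over $RM_{\boldsymbol p}(\mathbf A)$. Let $\mathscr E_N$ be the set of values of $\boldsymbol Y_N$ for which an MLE exists; the augmented MLE $\tilde{\boldsymbol p}_N$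 is equal to the MLE $\hat{\boldsymbol p}_N$ if $\boldsymbol Y_N\in\mathscr E_N$, and to $(1/I)\boldsymbol 1$ otherwise. \textbf{Theorem.} Let $\boldsymbol p_0\in RM_{\boldsymbol p}(\mathbf A)$ and, for every $N$, let $\boldsymbol Y_N\sim Mult(N,\boldsymbol p_0)$. Put $$\boldsymbol\Sigma=\Delta[\boldsymbol p_0]-\boldsymbol p_0\boldsymbol p_0',\qquad \mathbf H=\big(\boldsymbol 1,\ \Delta[\boldsymbol p_0^{-1}]\mathbf D'\big),\qquad \mathbf M=\mathbf I-\Delta[\boldsymbol p_0]\,\mathbf H\,(\mathbf H'\Delta[\boldsymbol p_0]\mathbf H)^{-1}\mathbf H'.$$ Then $\mathbf H'\Delta[\boldsymbol p_0]\mathbf H$ is invertible, $\mathbb P(\boldsymbol Y_N\in\mathscr E_N)>0$ for all sufficiently large $N$, and, as $N\to\infty$, (i) the conditional law of $N^{1/2}(\hat{\boldsymbol p}_N-\boldsymbol p_0)$ given $\boldsymbol Y_N\in\mathscr E_N$ converges weakly to $\mathcal N(\boldsymbol 0,\mathbf M\boldsymbol\Sigma\mathbf M')$; (ii) the law of $N^{1/2}(\tilde{\boldsymbol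 p}_N-\boldsymbol p_0)$ converges weakly to $\mathcal N(\boldsymbol 0,\mathbf M\boldsymbol\Sigma\mathbf M')$. -/

import Mathlib

open MeasureTheory ProbabilityTheory Filter Topology

noncomputable section

namespace RelationalModel

/-- A design matrix of a relational model: a `0`-`1` matrix of full row rank
(rows indexed by the effects, columns by the cells) with at least one `1` in every column. -/
structure IsDesignMatrix {κ ι : Type*} (A : Matrix κ ι ℝ) : Prop where
  zero_one : ∀ j i, A j i = 0 ∨ A j i = 1
  exists_one : ∀ i, ∃ j, A j i = 1
  fullRowRank : LinearIndependent ℝ A.row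

/-- The relational model for probabilities `RM_p(A)`: the strictly positive probability vectors `p`
on the cells such that `log p = A' θ` for some parameter vector `θ`. -/
def model {κ ι : Type*} [Fintype κ] [Fintype ι] (A : Matrix κ ι ℝ) : Set (ι → ℝ) :=
  {p | (∀ i, 0 < p i) ∧ ∑ i, p i = 1 ∧
    ∃ θ : κ → ℝ, (fun i => Real.log (p i)) = A.transpose.mulVec θ}

/-- `D` is a kernel basis matrix of `A`: its rows form a basis of `Ker(A)`. -/
structure IsKernelBasisMatrix {κ ι τ : Type*} [Fintype ι]
    (A : Matrix κ ι ℝ) (D : Matrix τ ι ℝ) : Prop where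
  linearIndependent : LinearIndependent ℝ D.row
  span_eq : Submodule.span ℝ (Set.range D.row) = LinearMap.ker A.mulVecLin

/-- The multinomial probability of the counts `y` in `∑ i, y i` trials with cell probabilities `p`;
as a function of `p`, the multinomial likelihood of the data `y`. -/
def likelihood {ι : Type*} [Fintype ι] (y : ι → ℕ) (p : ι → ℝ) : ℝ :=
  (Nat.multinomial Finset.univ y : ℝ) * ∏ i, p i ^ y i

/-- The multinomial distribution `Mult(N, p)`: the vector of counts `y`, with `∑ i, y i = N`,
has probability `N! / (∏ i, (y i)!) * ∏ i, p i ^ y i`. -/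
def multinomialLaw {ι : Type*} [Fintype ι] [DecidableEq ι] (N : ℕ) (p : ι → ℝ) :
    Measure (ι → ℕ) :=
  ∑ y ∈ Finset.piAntidiag Finset.univ N, ENNReal.ofReal (likelihood y p) • Measure.dirac y

/-- `p` is a maximum likelihood estimate under `RM_p(A)` for the data `y`: it lies in the model and
maximizes the multinomial likelihood over the model. -/
def IsMLE {κ ι : Type*} [Fintype κ] [Fintype ι] (A : Matrix κ ι ℝ) (y : ι → ℕ) (p : ι → ℝ) :
    Prop :=
  p ∈ model A ∧ IsMaxOn (likelihood y) (model A) p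

/-- The set of data vectors for which the MLE under `RM_p(A)` exists. -/
def mleExists {κ ι : Type*} [Fintype κ] [Fintype ι] (A : Matrix κ ι ℝ) : Set (ι → ℕ) :=
  {y | ∃ p, IsMLE A y p}

open Classical in
/-- The MLE under `RM_p(A)` for the data `y` (and the irrelevant value `0` when there is none). -/
def mle {κ ι : Type*} [Fintype κ] [Fintype ι] (A : Matrix κ ι ℝ) (y : ι → ℕ) : ι → ℝ :=
  if h : ∃ p, IsMLE A y p then h.choose else 0

open Classical in
/-- The augmented MLE: the MLE if it exists, and the uniform distribution `(1/I) 1` otherwise. -/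
def augmentedMLE {κ ι : Type*} [Fintype κ] [Fintype ι] (A : Matrix κ ι ℝ) (y : ι → ℕ) : ι → ℝ :=
  if y ∈ mleExists A then mle A y else fun _ => 1 / (Fintype.card ι : ℝ)

/-- The scaled error `N^{1/2} (p - p₀)`, as a vector of Euclidean space. -/
def scaledError {ι : Type*} (N : ℕ) (p₀ p : ι → ℝ) : EuclideanSpace ℝ ι :=
  WithLp.toLp 2 (Real.sqrt N • (p - p₀))

/-- `H = (1, Δ[p₀⁻¹] D')`. -/
def matH {ι τ : Type*} [Fintype ι] [DecidableEq ι] (p₀ : ι → ℝ) (D : Matrix τ ι ℝ) :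
    Matrix ι (Unit ⊕ τ) ℝ :=
  Matrix.fromCols (Matrix.replicateCol Unit (fun _ => (1 : ℝ)))
    (Matrix.diagonal (fun i => (p₀ i)⁻¹) * D.transpose)

/-- `H' Δ[p₀] H`. -/
def matGram {ι τ : Type*} [Fintype ι] [DecidableEq ι] (p₀ : ι → ℝ) (D : Matrix τ ι ℝ) :
    Matrix (Unit ⊕ τ) (Unit ⊕ τ) ℝ :=
  (matH p₀ D).transpose * Matrix.diagonal p₀ * matH p₀ D

/-- `M = I - Δ[p₀] H (H' Δ[p₀] H)⁻¹ H'`. -/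
def matM {ι τ : Type*} [Fintype ι] [DecidableEq ι] [Fintype τ] [DecidableEq τ]
    (p₀ : ι → ℝ) (D : Matrix τ ι ℝ) : Matrix ι ι ℝ :=
  1 - Matrix.diagonal p₀ * matH p₀ D * (matGram p₀ D)⁻¹ * (matH p₀ D).transpose

/-- `Σ = Δ[p₀] - p₀ p₀'`. -/
def matSigma {ι : Type*} [DecidableEq ι] (p₀ : ι → ℝ) : Matrix ι ι ℝ :=
  Matrix.diagonal p₀ - Matrix.vecMulVec p₀ p₀

/-- The limit law `N(0, M Σ M')`. -/
def limitLaw {ι τ : Type*} [Fintype ι] [DecidableEq ι] [Fintype τ] [DecidableEq τ]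
    (p₀ : ι → ℝ) (D : Matrix τ ι ℝ) : Measure (EuclideanSpace ℝ ι) :=
  multivariateGaussian 0 (matM p₀ D * matSigma p₀ * (matM p₀ D).transpose)

instance isProbabilityMeasure_limitLaw {ι τ : Type*} [Fintype ι] [DecidableEq ι] [Fintype τ]
    [DecidableEq τ] (p₀ : ι → ℝ) (D : Matrix τ ι ℝ) : IsProbabilityMeasure (limitLaw p₀ D) := by
  unfold limitLaw; infer_instance

/-- Convergence in law of `X N`, conditionally on the event `S N`, to the distribution `ν`: the
conditional distributions of `X N` given `S N` converge weakly to `ν`. The events have positive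
probability for all large `N`; `FiniteMeasure` is used since, for small `N`, an event `S N` may be
null, and `cond` is then the zero measure. -/
def TendstoInLawCond {E : Type*} [TopologicalSpace E] [MeasurableSpace E] [OpensMeasurableSpace E]
    {Ω : ℕ → Type*} [∀ N, MeasurableSpace (Ω N)] (P : ∀ N, Measure (Ω N))
    (X : ∀ N, Ω N → E) (S : ∀ N, Set (Ω N)) (ν : Measure E) [IsFiniteMeasure ν] : Prop :=
  (∀ N, AEMeasurable (X N) (P N)[|S N]) ∧
  (∀ᶠ N in atTop, 0 < P N (S N)) ∧
  Tendsto (β := FiniteMeasure E) (fun N => ⟨((P N)[|S N]).map (X N), inferInstance⟩) atTop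
    (𝓝 ⟨ν, inferInstance⟩)

end RelationalModel

end

/-!
Let `q = y / N` be the relative frequencies and `p` any MLE for `y`. The whole argument is a
deterministic expansion `p - p₀ = M (q - p₀) + O(‖q - p₀‖ ^ 2)` near `p₀`
(`exists_norm_mle_sub_le`), combined with the central limit theorem for `q`. Neither uniqueness of
the MLE nor the implicit function theorem is needed.

*Existence.* When all counts are positive, the likelihood attains its maximum over the model,
because its superlevel sets stay away from the boundary of the simplex (`exists_isMLE_of_pos`).

*Lipschitz bound.* The MLE fits `q` at least as well as `p₀` does, so the squared Hellinger distance
of `p` and `q` is at most the chi-squared divergence of `q` and `p₀`; hence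
`‖p - q‖ = O(‖q - p₀‖)` (`norm_sub_le_of_sum_log_le`).

*Linear term.* `M` is the projection onto the tangent space `{v | H' v = 0}` of the model at `p₀`
that annihilates `p₀` and `Ker A`. The likelihood equations say `A q = c A p`
(`IsMLE.exists_mulVec_eq`), where `c` may differ from `1` since the row space of `A` need not
contain the constants, but `c - 1 = O(‖q - p₀‖)`. Therefore `M (q - p₀) = c M (p - p₀)`. Moreover
`H' (p - p₀)` is of second order for `p` in the model, since `log p - log p₀` is orthogonal to the
rows of `D` (`norm_matH_transpose_mulVec_le`); so `p - p₀` is `M (p - p₀)` up to second order.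

*Limit law.* By the multinomial theorem the characteristic functions of `√N B (q - p₀)` are `N`-th
powers, and they converge to that of `N(0, B Σ B')` (`tendsto_charFun_linearError`). For `B = 1`
this gives tightness, so that the remainder of the expansion tends to `0` in probability and the MLE
exists with probability tending to `1` (`tendsto_measureReal_bad`); for `B = M` it identifies the
limit of the augmented MLE through Lévy's continuity theorem. Conditioning on an event of
probability tending to `1` does not affect the limit (`tendsto_integral_cond`).
-/

namespace RelationalModel

open Matrix

variable {ι κ τ : Type*}

/-! ### The projection onto the tangent space of the model -/

lemma one_le_sum_design [Fintype κ] {A : Matrix κ ι ℝ} (hA : IsDesignMatrix A) (i : ι) :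
    1 ≤ ∑ j, A j i := by
  obtain ⟨j, hj⟩ := hA.exists_one i
  rw [← hj]
  refine Finset.single_le_sum (f := fun j => A j i) (fun k _ => ?_) (Finset.mem_univ j)
  rcases hA.zero_one k i with h | h <;> simp [h]

/-- Summing all rows of the design matrix gives a positive functional that dominates `∑ i, p i`;
it plays the part of the total mass, which need not itself lie in the row space. -/
lemma sum_le_sum_mulVec_design [Fintype ι] [Fintype κ] {A : Matrix κ ι ℝ}
    (hA : IsDesignMatrix A) {p : ι → ℝ} (hp : ∀ i, 0 ≤ p i) :
    ∑ i, p i ≤ ∑ j, (A *ᵥ p) j := by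
  have h : ∑ j, (A *ᵥ p) j = ∑ i, (∑ j, A j i) * p i := by
    simp only [mulVec, dotProduct, Finset.sum_mul]
    exact Finset.sum_comm
  rw [h]
  exact Finset.sum_le_sum fun i _ => le_mul_of_one_le_left (hp i) (one_le_sum_design hA i)

lemma sum_mulVec_pos [Fintype ι] [Fintype κ] {A : Matrix κ ι ℝ} (hA : IsDesignMatrix A) {p : ι → ℝ}
    (hp : p ∈ model A) : 0 < ∑ j, (A *ᵥ p) j :=
  lt_of_lt_of_le (by rw [hp.2.1]; exact one_pos)
    (sum_le_sum_mulVec_design hA fun i => (hp.1 i).le)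

lemma kernelBasis_mulVec_row [Fintype ι] {A : Matrix κ ι ℝ} {D : Matrix τ ι ℝ}
    (hD : IsKernelBasisMatrix A D) (k : τ) : A *ᵥ D k = 0 := by
  have h : D.row k ∈ LinearMap.ker A.mulVecLin := by
    rw [← hD.span_eq]
    exact Submodule.subset_span ⟨k, rfl⟩
  exact h

lemma kernelBasis_mul_transpose [Fintype ι] [Fintype κ] {A : Matrix κ ι ℝ} {D : Matrix τ ι ℝ}
    (hD : IsKernelBasisMatrix A D) (θ : κ → ℝ) : D *ᵥ (Aᵀ *ᵥ θ) = 0 := by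
  ext k
  have h := kernelBasis_mulVec_row hD k
  calc (D *ᵥ (Aᵀ *ᵥ θ)) k = D k ⬝ᵥ (Aᵀ *ᵥ θ) := rfl
    _ = (A *ᵥ D k) ⬝ᵥ θ := by rw [dotProduct_mulVec, vecMul_transpose]
    _ = 0 := by rw [h, zero_dotProduct]

lemma exists_transpose_mulVec_eq [Fintype ι] [Fintype τ] {A : Matrix κ ι ℝ} {D : Matrix τ ι ℝ}
    (hD : IsKernelBasisMatrix A D) {v : ι → ℝ} (hv : A *ᵥ v = 0) : ∃ b, Dᵀ *ᵥ b = v := by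
  have h : v ∈ Submodule.span ℝ (Set.range D.row) := by
    rw [hD.span_eq]; simpa using hv
  obtain ⟨c, hc⟩ := (Submodule.mem_span_range_iff_exists_fun ℝ).1 h
  refine ⟨c, ?_⟩
  rw [← hc]
  ext i
  simp [mulVec, dotProduct, mul_comm]

section Projection

variable [Fintype ι] [DecidableEq ι]

lemma diagonal_mul_matH_mulVec [Fintype τ] {p₀ : ι → ℝ} (hpos : ∀ i, 0 < p₀ i) (D : Matrix τ ι ℝ)
    (w : Unit ⊕ τ → ℝ) :
    (diagonal p₀ * matH p₀ D) *ᵥ w = w (.inl ()) • p₀ + Dᵀ *ᵥ (w ∘ Sum.inr) := by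
  ext i
  have := (hpos i).ne'
  rw [← mulVec_mulVec, mulVec_diagonal]
  simp only [matH, mulVec, dotProduct, Fintype.sum_sum_type, fromCols_apply_inl,
    fromCols_apply_inr, diagonal_mul, replicateCol_apply, Pi.add_apply, Pi.smul_apply,
    smul_eq_mul, Function.comp, Finset.univ_unique, Finset.sum_singleton, one_mul, mul_add,
    Finset.mul_sum]
  congr 1
  · exact mul_comm _ _
  · refine Finset.sum_congr rfl fun k _ => ?_
    field_simp

lemma isUnit_matGram [Fintype κ] [Fintype τ] [DecidableEq τ] {A : Matrix κ ι ℝ}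
    (hA : IsDesignMatrix A) {D : Matrix τ ι ℝ} (hD : IsKernelBasisMatrix A D) {p₀ : ι → ℝ}
    (hp₀ : p₀ ∈ model A) : IsUnit (matGram p₀ D) := by
  have hinj : Function.Injective (matH p₀ D).mulVec := by
    refine (injective_iff_map_eq_zero (matH p₀ D).mulVecLin).2 fun w hw => ?_
    have hw' : w (.inl ()) • p₀ + Dᵀ *ᵥ (w ∘ Sum.inr) = 0 := by
      rw [← diagonal_mul_matH_mulVec hp₀.1, ← mulVec_mulVec]
      rw [mulVecLin_apply] at hw
      rw [hw, mulVec_zero]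
    have hDA : A *ᵥ (Dᵀ *ᵥ (w ∘ Sum.inr)) = 0 := by
      rw [mulVec_transpose]
      have h2 : A *ᵥ ((w ∘ Sum.inr) ᵥ* D) = ∑ k, w (.inr k) • A *ᵥ D k := by
        rw [vecMul_eq_sum, mulVec_sum]
        exact Finset.sum_congr rfl fun k _ => mulVec_smul _ _ _
      rw [h2]
      simp [kernelBasis_mulVec_row hD]
    -- `p₀` is not in the kernel of `A`, so its coefficient vanishes
    have h0 : w (.inl ()) = 0 := by
      have h1 := congrArg (fun v => ∑ j, (A *ᵥ v) j) hw'
      simp only [mulVec_add, hDA, mulVec_smul, add_zero, mulVec_zero, Pi.smul_apply,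
        smul_eq_mul, ← Finset.mul_sum, Pi.zero_apply, Finset.sum_const_zero] at h1
      exact (mul_eq_zero.1 h1).resolve_right (sum_mulVec_pos hA hp₀).ne'
    rw [h0, zero_smul, zero_add] at hw'
    have h3 : ∑ k, (w ∘ Sum.inr) k • D.row k = 0 := by
      rw [mulVec_transpose, vecMul_eq_sum] at hw'
      exact hw'
    have h4 := Fintype.linearIndependent_iff.1 hD.linearIndependent _ h3
    ext (j | k)
    · exact h0
    · exact h4 k
  have hpd := (PosDef.diagonal hp₀.1).conjTranspose_mul_mul_same hinj
  rw [conjTranspose_eq_transpose_of_trivial] at hpd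
  exact hpd.isUnit

lemma matH_transpose_mulVec (p₀ : ι → ℝ) (D : Matrix τ ι ℝ) (v : ι → ℝ) :
    (matH p₀ D)ᵀ *ᵥ v = Sum.elim (fun _ => ∑ i, v i) (D *ᵥ fun i => v i / p₀ i) := by
  ext (j | k)
  · simp [matH, mulVec, dotProduct]
  · simp only [matH, mulVec, dotProduct, transpose_apply, fromCols_apply_inr, diagonal_mul,
      Sum.elim_inr]
    refine Finset.sum_congr rfl fun i _ => ?_
    rw [div_eq_mul_inv]; ring

variable [Fintype τ] [DecidableEq τ]

lemma matM_mul_diagonal_mul_matH {p₀ : ι → ℝ} {D : Matrix τ ι ℝ} (hG : IsUnit (matGram p₀ D)) :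
    matM p₀ D * (diagonal p₀ * matH p₀ D) = 0 := by
  have h : (matH p₀ D)ᵀ * (diagonal p₀ * matH p₀ D) = matGram p₀ D := by
    rw [matGram, Matrix.mul_assoc]
  rw [matM, Matrix.sub_mul, Matrix.one_mul, Matrix.mul_assoc _ (matH p₀ D)ᵀ, h,
    Matrix.mul_assoc _ (matGram p₀ D)⁻¹,
    nonsing_inv_mul _ ((isUnit_iff_isUnit_det _).1 hG), Matrix.mul_one, sub_self]

lemma matM_mulVec_self {p₀ : ι → ℝ} {D : Matrix τ ι ℝ} (hpos : ∀ i, 0 < p₀ i)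
    (hG : IsUnit (matGram p₀ D)) : matM p₀ D *ᵥ p₀ = 0 := by
  have h := diagonal_mul_matH_mulVec hpos D (Sum.elim 1 0)
  have h2 : (0 : τ → ℝ) = Sum.elim (1 : Unit → ℝ) 0 ∘ Sum.inr := by simp
  rw [← h2, mulVec_zero] at h
  simp only [Sum.elim_inl, Pi.one_apply, one_smul, add_zero] at h
  have h3 := congrArg (matM p₀ D *ᵥ ·) h
  rwa [mulVec_mulVec, matM_mul_diagonal_mul_matH hG, zero_mulVec, eq_comm] at h3

lemma matM_mulVec_ker {A : Matrix κ ι ℝ} {D : Matrix τ ι ℝ} (hD : IsKernelBasisMatrix A D)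
    {p₀ : ι → ℝ} (hpos : ∀ i, 0 < p₀ i) (hG : IsUnit (matGram p₀ D)) {v : ι → ℝ}
    (hv : A *ᵥ v = 0) : matM p₀ D *ᵥ v = 0 := by
  obtain ⟨b, rfl⟩ := exists_transpose_mulVec_eq hD hv
  have h := diagonal_mul_matH_mulVec hpos D (Sum.elim 0 b)
  simp only [Sum.elim_inl, Pi.zero_apply, zero_smul, zero_add, Sum.elim_comp_inr] at h
  rw [← h, mulVec_mulVec, matM_mul_diagonal_mul_matH hG, zero_mulVec]

lemma eq_matM_mulVec_add (p₀ : ι → ℝ) (D : Matrix τ ι ℝ) (v : ι → ℝ) :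
    v = matM p₀ D *ᵥ v +
      (diagonal p₀ * matH p₀ D * (matGram p₀ D)⁻¹) *ᵥ ((matH p₀ D)ᵀ *ᵥ v) := by
  rw [matM, sub_mulVec, one_mulVec, mulVec_mulVec, sub_add_cancel]

end Projection

lemma exists_norm_mulVec_le {m n : Type*} [Fintype m] [Fintype n] (B : Matrix m n ℝ) :
    ∃ C, 0 ≤ C ∧ ∀ v, ‖B *ᵥ v‖ ≤ C * ‖v‖ :=
  ⟨_, norm_nonneg _, (LinearMap.toContinuousLinearMap B.mulVecLin).le_opNorm⟩

/-! ### Existence of the maximum likelihood estimate -/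

lemma multinomial_cast_pos [Fintype ι] (y : ι → ℕ) :
    (0 : ℝ) < (Nat.multinomial Finset.univ y : ℝ) := by
  exact_mod_cast Nat.multinomial_pos _ _

lemma le_one_of_mem_model [Fintype κ] [Fintype ι] {A : Matrix κ ι ℝ} {p : ι → ℝ}
    (hp : p ∈ model A) (i : ι) : p i ≤ 1 := by
  rw [← hp.2.1]
  exact Finset.single_le_sum (f := p) (fun j _ => (hp.1 j).le) (Finset.mem_univ i)

lemma prod_pow_le_apply [Fintype ι] {p : ι → ℝ} (h0 : ∀ i, 0 ≤ p i) (h1 : ∀ i, p i ≤ 1)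
    {y : ι → ℕ} {i : ι} (hy : 0 < y i) : ∏ j, p j ^ y j ≤ p i := by
  classical
  rw [← Finset.mul_prod_erase _ _ (Finset.mem_univ i)]
  calc p i ^ y i * ∏ j ∈ Finset.univ.erase i, p j ^ y j
      ≤ p i ^ y i * 1 := by
        refine mul_le_mul_of_nonneg_left ?_ (pow_nonneg (h0 i) _)
        exact Finset.prod_le_one (fun j _ => pow_nonneg (h0 j) _)
          fun j _ => pow_le_one₀ (h0 j) (h1 j)
    _ ≤ p i := by
        rw [mul_one]
        exact pow_le_of_le_one (h0 i) (h1 i) hy.ne'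

/-- If every cell has been observed, an MLE exists. A point of the model with a coordinate below
`ε = ∏ i, p₀ i ^ y i` has a smaller likelihood than `p₀`, and the points of the model with all
coordinates at least `ε` form a compact set. -/
lemma exists_isMLE_of_pos [Fintype κ] [Fintype ι] {A : Matrix κ ι ℝ} {p₀ : ι → ℝ}
    (hp₀ : p₀ ∈ model A) {y : ι → ℕ} (hy : ∀ i, 0 < y i) : y ∈ mleExists A := by
  set ε : ℝ := ∏ i, p₀ i ^ y i with hε
  have hεpos : 0 < ε := Finset.prod_pos fun i _ => pow_pos (hp₀.1 i) _
  set K : Set (ι → ℝ) := {p | p ∈ model A ∧ ∀ i, ε ≤ p i} with hK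
  have hp₀K : p₀ ∈ K := ⟨hp₀, fun i => prod_pow_le_apply (fun j => (hp₀.1 j).le)
    (le_one_of_mem_model hp₀) (hy i)⟩
  have hcomp : IsCompact K := by
    have hbox : IsClosed {p : ι → ℝ | ∀ i, ε ≤ p i} := by
      rw [Set.ofPred_forall]
      exact isClosed_iInter fun i => isClosed_le continuous_const (continuous_apply i)
    have hlog : ContinuousOn (fun (p : ι → ℝ) i => Real.log (p i)) {p : ι → ℝ | ∀ i, ε ≤ p i} :=
      continuousOn_pi.2 fun i => (continuous_apply i).continuousOn.log
        fun p hp => (hεpos.trans_le (hp i)).ne'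
    have hc1 : IsClosed ({p : ι → ℝ | ∀ i, ε ≤ p i} ∩
        (fun (p : ι → ℝ) i => Real.log (p i)) ⁻¹'
          (LinearMap.range (Aᵀ).mulVecLin : Set (ι → ℝ))) :=
      hlog.preimage_isClosed_of_isClosed hbox (Submodule.closed_of_finiteDimensional _)
    have hc2 : IsClosed {p : ι → ℝ | ∑ i, p i = 1} :=
      isClosed_eq (continuous_finsetSum _ fun i _ => continuous_apply i) continuous_const
    refine (isCompact_Icc (a := fun _ : ι => (0 : ℝ)) (b := fun _ => 1)).of_isClosed_subset
      ?_ (fun p hp => ⟨fun i => (hp.1.1 i).le, le_one_of_mem_model hp.1⟩)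
    convert hc1.inter hc2 using 1
    ext p
    constructor
    · rintro ⟨⟨_, h2, θ, h3⟩, h4⟩
      exact ⟨⟨h4, θ, h3.symm⟩, h2⟩
    · rintro ⟨⟨h4, θ, h3⟩, h2⟩
      exact ⟨⟨fun i => hεpos.trans_le (h4 i), h2, θ, h3.symm⟩, h4⟩
  have hcont : Continuous (fun p : ι → ℝ => ∏ i, p i ^ y i) :=
    continuous_finsetProd _ fun i _ => (continuous_apply i).pow _
  obtain ⟨p, hpK, hmax⟩ := hcomp.exists_isMaxOn ⟨p₀, hp₀K⟩ hcont.continuousOn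
  refine ⟨p, hpK.1, fun p' hp' => ?_⟩
  refine mul_le_mul_of_nonneg_left ?_ (multinomial_cast_pos y).le
  by_cases h : ∀ i, ε ≤ p' i
  · exact hmax ⟨hp', h⟩
  · push Not at h
    obtain ⟨i, hi⟩ := h
    have h1 := prod_pow_le_apply (fun j => (hp'.1 j).le) (le_one_of_mem_model hp') (hy i)
    exact (h1.trans hi.le).trans (hmax hp₀K)

/-! ### The estimate is close to the truth -/

lemma log_prod_pow [Fintype ι] {p : ι → ℝ} (hp : ∀ i, 0 < p i) (y : ι → ℕ) :
    Real.log (∏ i, p i ^ y i) = ∑ i, y i * Real.log (p i) := by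
  rw [Real.log_prod fun i _ => (pow_pos (hp i) _).ne']
  simp

lemma IsMLE.sum_log_le [Fintype κ] [Fintype ι] {A : Matrix κ ι ℝ} {y : ι → ℕ} {p p' : ι → ℝ}
    (h : IsMLE A y p) (hp' : p' ∈ model A) :
    ∑ i, y i * Real.log (p' i) ≤ ∑ i, y i * Real.log (p i) := by
  rw [← log_prod_pow hp'.1, ← log_prod_pow h.1.1]
  exact Real.log_le_log (Finset.prod_pos fun i _ => pow_pos (hp'.1 i) _)
    (le_of_mul_le_mul_left (h.2 hp') (multinomial_cast_pos y))

/-- If `p` fits the data `q` at least as well as `p₀`, then the squared Hellinger distance of `p`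
and `q` is at most the chi-squared divergence of `q` and `p₀`: the former is bounded by the
Kullback–Leibler divergence of `q` from `p`, the latter bounds the one of `q` from `p₀`. -/
lemma sum_sq_sqrt_sub_sqrt_le [Fintype ι] {p q p₀ : ι → ℝ} (hp : ∀ i, 0 < p i)
    (hq : ∀ i, 0 < q i) (hp₀ : ∀ i, 0 < p₀ i) (hp1 : ∑ i, p i = 1) (hq1 : ∑ i, q i = 1)
    (hp₀1 : ∑ i, p₀ i = 1)
    (h : ∑ i, q i * Real.log (p₀ i) ≤ ∑ i, q i * Real.log (p i)) :
    ∑ i, (√(p i) - √(q i)) ^ 2 ≤ ∑ i, (q i - p₀ i) ^ 2 / p₀ i := by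
  have h1 : ∀ i, q i * Real.log (p i) - q i * Real.log (q i) ≤
      p i - q i - (√(p i) - √(q i)) ^ 2 := fun i => by
    have hs : 0 < √(p i) := Real.sqrt_pos.2 (hp i)
    have ht : 0 < √(q i) := Real.sqrt_pos.2 (hq i)
    have hl := Real.log_le_sub_one_of_pos (div_pos hs ht)
    rw [Real.log_div hs.ne' ht.ne', Real.log_sqrt (hp i).le, Real.log_sqrt (hq i).le] at hl
    have hps := Real.sq_sqrt (hp i).le
    have hqs := Real.sq_sqrt (hq i).le
    have hm := mul_le_mul_of_nonneg_left hl (hq i).le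
    have he : q i * (√(p i) / √(q i) - 1) = √(p i) * √(q i) - q i := by
      rw [mul_sub, mul_one]
      congr 1
      nth_rewrite 1 [← hqs]
      field_simp
    rw [he] at hm
    nlinarith
  have h2 : ∀ i, q i * Real.log (q i) - q i * Real.log (p₀ i) ≤
      (q i - p₀ i) ^ 2 / p₀ i + (q i - p₀ i) := fun i => by
    have hl := Real.log_le_sub_one_of_pos (div_pos (hq i) (hp₀ i))
    rw [Real.log_div (hq i).ne' (hp₀ i).ne'] at hl
    have hm := mul_le_mul_of_nonneg_left hl (hq i).le
    have hne := (hp₀ i).ne'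
    have he : q i * (q i / p₀ i - 1) = (q i - p₀ i) ^ 2 / p₀ i + (q i - p₀ i) := by
      field_simp; ring
    rw [he] at hm
    linarith
  have s1 := Finset.sum_le_sum fun i (_ : i ∈ Finset.univ) => h1 i
  have s2 := Finset.sum_le_sum fun i (_ : i ∈ Finset.univ) => h2 i
  simp only [Finset.sum_sub_distrib, Finset.sum_add_distrib, hp1, hq1, hp₀1] at s1 s2
  linarith

/-- The distance of an estimate `p` from the data `q` is of the order of that of `q` from `p₀`. -/
lemma norm_sub_le_of_sum_log_le [Fintype ι] {p q p₀ : ι → ℝ} (hp : ∀ i, 0 < p i)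
    (hq : ∀ i, 0 < q i) (hp₀ : ∀ i, 0 < p₀ i) (hp1 : ∑ i, p i = 1) (hq1 : ∑ i, q i = 1)
    (hp₀1 : ∑ i, p₀ i = 1)
    (h : ∑ i, q i * Real.log (p₀ i) ≤ ∑ i, q i * Real.log (p i)) :
    ‖p - q‖ ≤ 2 * √(∑ i, (p₀ i)⁻¹) * ‖q - p₀‖ := by
  have hK : 0 ≤ ∑ i, (p₀ i)⁻¹ := Finset.sum_nonneg fun i _ => (inv_pos.2 (hp₀ i)).le
  have hH := sum_sq_sqrt_sub_sqrt_le hp hq hp₀ hp1 hq1 hp₀1 h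
  have hchi : ∑ i, (q i - p₀ i) ^ 2 / p₀ i ≤ (∑ i, (p₀ i)⁻¹) * ‖q - p₀‖ ^ 2 := by
    rw [Finset.sum_mul]
    refine Finset.sum_le_sum fun i _ => ?_
    rw [div_eq_inv_mul]
    refine mul_le_mul_of_nonneg_left ?_ (inv_pos.2 (hp₀ i)).le
    rw [← sq_abs]
    exact pow_le_pow_left₀ (abs_nonneg _) (norm_le_pi_norm (q - p₀) i) 2
  refine (pi_norm_le_iff_of_nonneg (by positivity)).2 fun i => ?_
  have hle1 : ∀ r : ι → ℝ, (∀ i, 0 < r i) → ∑ i, r i = 1 → √(r i) ≤ 1 := fun r hr hr1 =>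
    Real.sqrt_le_one.2 (hr1 ▸ Finset.single_le_sum (f := r) (fun j _ => (hr j).le)
      (Finset.mem_univ i))
  have hs : (√(p i) - √(q i)) ^ 2 ≤ (√(∑ i, (p₀ i)⁻¹) * ‖q - p₀‖) ^ 2 := by
    rw [mul_pow, Real.sq_sqrt hK]
    exact ((Finset.single_le_sum (f := fun i => (√(p i) - √(q i)) ^ 2)
      (fun j _ => sq_nonneg _) (Finset.mem_univ i)).trans hH).trans hchi
  have habs := abs_le_of_sq_le_sq hs (by positivity)
  have hfac : (p - q) i = (√(p i) - √(q i)) * (√(p i) + √(q i)) := by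
    have h1 := Real.sq_sqrt (hp i).le
    have h2 := Real.sq_sqrt (hq i).le
    simp only [Pi.sub_apply]
    nlinarith
  rw [hfac, norm_mul, Real.norm_eq_abs, Real.norm_eq_abs,
    abs_of_nonneg (add_nonneg (Real.sqrt_nonneg (p i)) (Real.sqrt_nonneg (q i)))]
  calc |√(p i) - √(q i)| * (√(p i) + √(q i))
      ≤ (√(∑ i, (p₀ i)⁻¹) * ‖q - p₀‖) * 2 := by
        refine mul_le_mul habs ?_ (by positivity) (by positivity)
        linarith [hle1 p hp hp1, hle1 q hq hq1]
    _ = _ := by ring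

/-! ### The likelihood equations -/

/-- The likelihood equations `A y = c A p`, from the Lagrange multiplier theorem for the linear
function `θ ↦ ∑ i, y i * (A' θ) i` on the level set `∑ i, exp ((A' θ) i) = 1`. When the row space
of `A` does not contain the constants, `c` need not be the number of trials. -/
lemma IsMLE.exists_mulVec_eq [Fintype κ] [Fintype ι] {A : Matrix κ ι ℝ} (hA : IsDesignMatrix A)
    {y : ι → ℕ} {p : ι → ℝ} (h : IsMLE A y p) :
    ∃ c : ℝ, A *ᵥ (fun i => (y i : ℝ)) = c • A *ᵥ p := by
  classical
  obtain ⟨θ, hθ⟩ := h.1.2.2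
  have hpexp : ∀ i, Real.exp ((Aᵀ *ᵥ θ) i) = p i := fun i => by
    rw [← hθ]; exact Real.exp_log (h.1.1 i)
  set ℓ : ι → StrongDual ℝ (κ → ℝ) := fun i =>
    (ContinuousLinearMap.proj i).comp (LinearMap.toContinuousLinearMap (Aᵀ).mulVecLin) with hℓ
  have hℓa : ∀ i (η : κ → ℝ), ℓ i η = (Aᵀ *ᵥ η) i := fun i η => rfl
  have hder : ∀ i, HasStrictFDerivAt (fun η : κ → ℝ => (Aᵀ *ᵥ η) i) (ℓ i) θ := fun i =>
    (ℓ i).hasStrictFDerivAt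
  have hf : HasStrictFDerivAt (fun η : κ → ℝ => ∑ i, Real.exp ((Aᵀ *ᵥ η) i))
      (∑ i, Real.exp ((Aᵀ *ᵥ θ) i) • ℓ i) θ :=
    HasStrictFDerivAt.fun_sum fun i _ => (hder i).exp
  have hφ : HasStrictFDerivAt (fun η : κ → ℝ => ∑ i, (y i : ℝ) * (Aᵀ *ᵥ η) i)
      (∑ i, (y i : ℝ) • ℓ i) θ :=
    HasStrictFDerivAt.fun_sum fun i _ => (hder i).const_mul _
  have hext : IsLocalExtrOn (fun η : κ → ℝ => ∑ i, (y i : ℝ) * (Aᵀ *ᵥ η) i)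
      {η | ∑ i, Real.exp ((Aᵀ *ᵥ η) i) = ∑ i, Real.exp ((Aᵀ *ᵥ θ) i)} θ := by
    refine Or.inr (IsMaxOn.localize fun η hη => ?_)
    simp only [Set.mem_ofPred_eq, hpexp, h.1.2.1] at hη
    have hmem : (fun i => Real.exp ((Aᵀ *ᵥ η) i)) ∈ model A :=
      ⟨fun i => Real.exp_pos _, hη, η, by simp⟩
    have hle := h.sum_log_le hmem
    simp only [Real.log_exp] at hle
    have hl : ∀ i, Real.log (p i) = (Aᵀ *ᵥ θ) i := fun i => congrFun hθ i
    simp only [hl] at hle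
    exact hle
  obtain ⟨a, b, hab, hlin⟩ := hext.exists_multipliers_of_hasStrictFDerivAt_1d hf hφ
  -- the multiplier equation, paired with the coordinate vectors
  have hcoord : ∀ j, a * (A *ᵥ p) j + b * (A *ᵥ fun i => (y i : ℝ)) j = 0 := fun j => by
    have hj := DFunLike.congr_fun hlin (Pi.single j 1)
    simp only [_root_.add_apply, _root_.smul_apply, _root_.sum_apply, hℓa, hpexp, smul_eq_mul,
      mulVec_single_one, _root_.zero_apply] at hj
    simpa [mulVec, dotProduct, mul_comm] using hj
  have hsum : a * (∑ j, (A *ᵥ p) j) + b * (∑ j, (A *ᵥ fun i => (y i : ℝ)) j) = 0 := by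
    rw [Finset.mul_sum, Finset.mul_sum, ← Finset.sum_add_distrib]
    exact Finset.sum_eq_zero fun j _ => hcoord j
  have hb : b ≠ 0 := by
    rintro rfl
    rw [zero_mul, add_zero] at hsum
    have ha := (mul_eq_zero.1 hsum).resolve_right (sum_mulVec_pos hA h.1).ne'
    exact hab (by rw [ha]; rfl)
  refine ⟨-a / b, ?_⟩
  ext j
  have := hcoord j
  simp only [Pi.smul_apply, smul_eq_mul]
  field_simp
  linarith

/-! ### The linear expansion of the estimate -/

lemma abs_sub_log_one_add_le {u : ℝ} (hu : -(1 / 2) ≤ u) : |u - Real.log (1 + u)| ≤ 2 * u ^ 2 := by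
  have hpos : 0 < 1 + u := by linarith
  have h1 := Real.log_le_sub_one_of_pos hpos
  have h2 := Real.one_sub_inv_le_log_of_pos hpos
  have h3 : 1 - (1 + u)⁻¹ = u - u ^ 2 * (1 + u)⁻¹ := by field_simp; ring
  have h4 : (1 + u)⁻¹ ≤ 2 := inv_le_of_inv_le₀ (by norm_num) (by linarith)
  rw [abs_of_nonneg (by linarith)]
  nlinarith [mul_le_mul_of_nonneg_left h4 (sq_nonneg u)]

/-- Near `p₀` the model is tangent to `{v | H' v = 0}`: for `p` in the model, `H' (p - p₀)` is of
second order. -/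
lemma norm_matH_transpose_mulVec_le [Fintype ι] [DecidableEq ι] [Fintype κ] [Fintype τ]
    {A : Matrix κ ι ℝ} {D : Matrix τ ι ℝ} (hD : IsKernelBasisMatrix A D) {p₀ p : ι → ℝ}
    (hp₀ : p₀ ∈ model A) (hp : p ∈ model A) {m : ℝ} (hm : 0 < m) (hmp : ∀ i, m ≤ p₀ i)
    (hnear : ‖p - p₀‖ ≤ m / 2) {C : ℝ} (hC : 0 ≤ C) (hDC : ∀ v, ‖D *ᵥ v‖ ≤ C * ‖v‖) :
    ‖(matH p₀ D)ᵀ *ᵥ (p - p₀)‖ ≤ C * (2 / m ^ 2) * ‖p - p₀‖ ^ 2 := by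
  obtain ⟨θ, hθ⟩ := hp.2.2
  obtain ⟨θ₀, hθ₀⟩ := hp₀.2.2
  set u : ι → ℝ := fun i => (p - p₀) i / p₀ i with hu
  have hratio : ∀ i, 1 + u i = p i / p₀ i := fun i => by
    have := (hp₀.1 i).ne'
    simp only [hu, Pi.sub_apply]; field_simp; ring
  have hlog : (fun i => Real.log (1 + u i)) = Aᵀ *ᵥ (θ - θ₀) := by
    rw [mulVec_sub, ← hθ, ← hθ₀]
    ext i
    rw [hratio, Real.log_div (hp.1 i).ne' (hp₀.1 i).ne', Pi.sub_apply]
  have hDu : D *ᵥ u = D *ᵥ (u - fun i => Real.log (1 + u i)) := by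
    rw [mulVec_sub, hlog, kernelBasis_mul_transpose hD, sub_zero]
  have habs : ∀ i, |u i| ≤ ‖p - p₀‖ / m := fun i => by
    rw [hu, abs_div, abs_of_pos (hp₀.1 i)]
    exact div_le_div₀ (norm_nonneg _) (norm_le_pi_norm (p - p₀) i) hm (hmp i)
  have hbound : ‖u - fun i => Real.log (1 + u i)‖ ≤ 2 / m ^ 2 * ‖p - p₀‖ ^ 2 := by
    refine (pi_norm_le_iff_of_nonneg (by positivity)).2 fun i => ?_
    have hhalf : ‖p - p₀‖ / m ≤ 1 / 2 := by
      rw [div_le_iff₀ hm]; linarith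
    have h1 := abs_sub_log_one_add_le
      (neg_le_of_neg_le (((neg_le_abs (u i)).trans (habs i)).trans hhalf))
    have h2 : u i ^ 2 ≤ (‖p - p₀‖ / m) ^ 2 := by
      rw [← sq_abs]
      exact pow_le_pow_left₀ (abs_nonneg _) (habs i) 2
    refine h1.trans ((mul_le_mul_of_nonneg_left h2 zero_le_two).trans_eq ?_)
    rw [div_pow]; ring
  rw [matH_transpose_mulVec]
  refine (pi_norm_le_iff_of_nonneg (by positivity)).2 fun j => ?_
  rcases j with j | k
  · have h0 : ∑ i, (p - p₀) i = 0 := by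
      simp [Finset.sum_sub_distrib, hp.2.1, hp₀.2.1]
    rw [Sum.elim_inl, h0, norm_zero]
    positivity
  · rw [Sum.elim_inr]
    change ‖(D *ᵥ u) k‖ ≤ _
    calc ‖(D *ᵥ u) k‖ ≤ ‖D *ᵥ u‖ := norm_le_pi_norm _ k
      _ ≤ C * ‖u - fun i => Real.log (1 + u i)‖ := hDu ▸ hDC _
      _ ≤ C * (2 / m ^ 2 * ‖p - p₀‖ ^ 2) := mul_le_mul_of_nonneg_left hbound hC
      _ = _ := by ring

/-- Near `p₀`, the MLE exists and equals `p₀ + M (q - p₀)` up to an error of second order in the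
deviation of the relative frequencies `q` from `p₀`. -/
theorem exists_norm_mle_sub_le [Fintype ι] [DecidableEq ι] [Fintype κ] [Fintype τ] [DecidableEq τ]
    {A : Matrix κ ι ℝ} (hA : IsDesignMatrix A) {D : Matrix τ ι ℝ} (hD : IsKernelBasisMatrix A D)
    {p₀ : ι → ℝ} (hp₀ : p₀ ∈ model A) :
    ∃ C δ : ℝ, 0 ≤ C ∧ 0 < δ ∧ ∀ (N : ℕ) (y : ι → ℕ) (q : ι → ℝ), 0 < N → ∑ i, y i = N →
      q = (fun i => (y i : ℝ) / N) → ‖q - p₀‖ ≤ δ →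
      y ∈ mleExists A ∧
        ∀ p, IsMLE A y p → ‖p - p₀ - matM p₀ D *ᵥ (q - p₀)‖ ≤ C * ‖q - p₀‖ ^ 2 := by
  have hG := isUnit_matGram hA hD hp₀
  obtain ⟨m, hm, hmp⟩ : ∃ m > 0, ∀ i, m ≤ p₀ i := by
    rcases isEmpty_or_nonempty ι with hι | hι
    · exact ⟨1, one_pos, fun i => hι.elim i⟩
    · obtain ⟨i₀, h⟩ := Finite.exists_min p₀
      exact ⟨p₀ i₀, hp₀.1 i₀, h⟩
  obtain ⟨CD, hCD0, hCD⟩ := exists_norm_mulVec_le D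
  obtain ⟨CA, hCA0, hCA⟩ := exists_norm_mulVec_le A
  obtain ⟨CM, hCM0, hCM⟩ := exists_norm_mulVec_le (matM p₀ D)
  obtain ⟨CB, hCB0, hCB⟩ :=
    exists_norm_mulVec_le (diagonal p₀ * matH p₀ D * (matGram p₀ D)⁻¹)
  set L : ℝ := 2 * √(∑ i, (p₀ i)⁻¹) with hL
  have hL0 : 0 ≤ L := by positivity
  refine ⟨CB * (CD * (2 / m ^ 2) * (L + 1) ^ 2) + Fintype.card κ * CA * L * CM * (L + 1),
    m / (2 * (L + 1)), by positivity, by positivity, ?_⟩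
  intro N y q hN hyN hq hnear
  have hN' : (0 : ℝ) < N := Nat.cast_pos.2 hN
  have hnear' : (L + 1) * ‖q - p₀‖ ≤ m / 2 := by
    have h := mul_le_mul_of_nonneg_left hnear (by positivity : 0 ≤ L + 1)
    refine h.trans_eq ?_
    field_simp
  have hqpos : ∀ i, 0 < q i := fun i => by
    have h1 : ‖q - p₀‖ ≤ m / 2 := by nlinarith [norm_nonneg (q - p₀)]
    have h2 := (abs_le.1 ((norm_le_pi_norm (q - p₀) i).trans h1)).1
    have h3 := hmp i
    simp only [Pi.sub_apply] at h2
    linarith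
  have hypos : ∀ i, 0 < y i := fun i => by
    have h := hqpos i
    rw [hq] at h
    rcases Nat.eq_zero_or_pos (y i) with h0 | h0
    · simp [h0] at h
    · exact h0
  have hq1 : ∑ i, q i = 1 := by
    rw [hq, ← Finset.sum_div, ← Nat.cast_sum, hyN, div_self hN'.ne']
  refine ⟨exists_isMLE_of_pos hp₀ hypos, fun p hp => ?_⟩
  have hpm := hp.1
  have hscale : ∀ r : ι → ℝ, ∑ i, q i * r i = (∑ i, y i * r i) / N := fun r => by
    rw [hq, Finset.sum_div]
    exact Finset.sum_congr rfl fun i _ => by ring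
  have hpq : ‖p - q‖ ≤ L * ‖q - p₀‖ := by
    refine norm_sub_le_of_sum_log_le hpm.1 hqpos hp₀.1 hpm.2.1 hq1 hp₀.2.1 ?_
    rw [hscale, hscale]
    exact div_le_div_of_nonneg_right (hp.sum_log_le hp₀) hN'.le
  have hpp₀ : ‖p - p₀‖ ≤ (L + 1) * ‖q - p₀‖ := by
    rw [← sub_add_sub_cancel p q p₀, add_mul, one_mul]
    exact (norm_add_le _ _).trans (add_le_add_left hpq _)
  obtain ⟨c, hc⟩ := hp.exists_mulVec_eq hA
  have hlam : A *ᵥ q = (c / N) • A *ᵥ p := by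
    have hqs : q = (N : ℝ)⁻¹ • fun i => (y i : ℝ) := by
      rw [hq]; ext i; simp [div_eq_inv_mul]
    rw [hqs, mulVec_smul, hc, smul_smul, div_eq_inv_mul]
  -- the multiplier is close to `1`: compare the sums of the coordinates of `A q` and `A p`
  have hlam1 : |1 - c / N| ≤ Fintype.card κ * CA * L * ‖q - p₀‖ := by
    have hs : ∑ j, (A *ᵥ (p - q)) j = (1 - c / N) * ∑ j, (A *ᵥ p) j := by
      rw [mulVec_sub, hlam, Finset.mul_sum]
      exact Finset.sum_congr rfl fun j _ => by
        simp only [Pi.sub_apply, Pi.smul_apply, smul_eq_mul]; ring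
    have h1 : 1 ≤ ∑ j, (A *ᵥ p) j :=
      hpm.2.1 ▸ sum_le_sum_mulVec_design hA fun i => (hpm.1 i).le
    calc |1 - c / N| ≤ |1 - c / N| * |∑ j, (A *ᵥ p) j| :=
          le_mul_of_one_le_right (abs_nonneg _) (h1.trans (le_abs_self _))
      _ = |∑ j, (A *ᵥ (p - q)) j| := by rw [← abs_mul, ← hs]
      _ ≤ ∑ j, |(A *ᵥ (p - q)) j| := Finset.abs_sum_le_sum_abs _ _
      _ ≤ ∑ _j : κ, CA * (L * ‖q - p₀‖) := Finset.sum_le_sum fun j _ =>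
          ((norm_le_pi_norm (A *ᵥ (p - q)) j).trans (hCA _)).trans
            (mul_le_mul_of_nonneg_left hpq hCA0)
      _ = _ := by
          rw [Finset.sum_const, Finset.card_univ, nsmul_eq_mul]; ring
  have hMq : matM p₀ D *ᵥ (q - p₀) = (c / N) • matM p₀ D *ᵥ (p - p₀) := by
    have hker : matM p₀ D *ᵥ (q - (c / N) • p) = 0 :=
      matM_mulVec_ker hD hp₀.1 hG (by rw [mulVec_sub, mulVec_smul, hlam, sub_self])
    rw [mulVec_sub, mulVec_smul, sub_eq_zero] at hker
    rw [mulVec_sub, mulVec_sub, matM_mulVec_self hp₀.1 hG, sub_zero, sub_zero, hker]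
  have hdecomp : p - p₀ - matM p₀ D *ᵥ (q - p₀) =
      (diagonal p₀ * matH p₀ D * (matGram p₀ D)⁻¹) *ᵥ ((matH p₀ D)ᵀ *ᵥ (p - p₀)) +
        (1 - c / N) • matM p₀ D *ᵥ (p - p₀) := by
    rw [hMq, sub_smul, one_smul]
    nth_rewrite 1 [eq_matM_mulVec_add p₀ D (p - p₀)]
    abel
  have hHt := norm_matH_transpose_mulVec_le hD hp₀ hpm hm hmp (hpp₀.trans hnear') hCD0 hCD
  have hsq : ‖p - p₀‖ ^ 2 ≤ (L + 1) ^ 2 * ‖q - p₀‖ ^ 2 := by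
    rw [← mul_pow]
    exact pow_le_pow_left₀ (norm_nonneg _) hpp₀ 2
  rw [hdecomp, add_mul]
  refine (norm_add_le _ _).trans (add_le_add ?_ ?_)
  · refine (hCB _).trans ?_
    rw [mul_assoc CB]
    refine mul_le_mul_of_nonneg_left (hHt.trans ?_) hCB0
    rw [mul_assoc (CD * (2 / m ^ 2))]
    exact mul_le_mul_of_nonneg_left hsq (by positivity)
  · rw [norm_smul, Real.norm_eq_abs]
    calc |1 - c / N| * ‖matM p₀ D *ᵥ (p - p₀)‖
        ≤ (Fintype.card κ * CA * L * ‖q - p₀‖) * (CM * ((L + 1) * ‖q - p₀‖)) :=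
          mul_le_mul hlam1 ((hCM _).trans (mul_le_mul_of_nonneg_left hpp₀ hCM0))
            (norm_nonneg _) (by positivity)
      _ = _ := by ring

/-! ### The central limit theorem for the multinomial distribution -/

lemma integral_multinomialLaw [Fintype ι] [DecidableEq ι] {F : Type*} [NormedAddCommGroup F]
    [NormedSpace ℝ F] [CompleteSpace F] (N : ℕ) {p : ι → ℝ} (hp : ∀ i, 0 ≤ p i)
    (f : (ι → ℕ) → F) :
    ∫ y, f y ∂(multinomialLaw N p) =
      ∑ y ∈ Finset.piAntidiag Finset.univ N, likelihood y p • f y := by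
  rw [multinomialLaw, integral_finsetSum_measure]
  · refine Finset.sum_congr rfl fun y _ => ?_
    rw [integral_smul_measure, integral_dirac, ENNReal.toReal_ofReal]
    exact mul_nonneg (Nat.cast_nonneg _) (Finset.prod_nonneg fun i _ => pow_nonneg (hp i) _)
  · intro y _
    exact (integrable_dirac (by simp)).smul_measure ENNReal.ofReal_ne_top

lemma isProbabilityMeasure_multinomialLaw [Fintype ι] [DecidableEq ι] (N : ℕ) {p : ι → ℝ}
    (hp : ∀ i, 0 ≤ p i) (hp1 : ∑ i, p i = 1) : IsProbabilityMeasure (multinomialLaw N p) := by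
  constructor
  rw [multinomialLaw, Measure.finsetSum_apply]
  simp only [Measure.smul_apply, measure_univ, smul_eq_mul, mul_one]
  rw [← ENNReal.ofReal_sum_of_nonneg (f := fun y => likelihood y p) fun y _ =>
    mul_nonneg (Nat.cast_nonneg _) (Finset.prod_nonneg fun i _ => pow_nonneg (hp i) _)]
  have h := Finset.sum_pow_eq_sum_piAntidiag Finset.univ p N
  rw [hp1, one_pow] at h
  simp only [likelihood, ← h, ENNReal.ofReal_one]

lemma ae_multinomialLaw_sum_eq [Fintype ι] [DecidableEq ι] (N : ℕ) (p : ι → ℝ) :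
    ∀ᵐ y ∂(multinomialLaw N p), ∑ i, y i = N := by
  rw [multinomialLaw, ae_iff, Measure.finsetSum_apply]
  refine Finset.sum_eq_zero fun y hy => ?_
  have : ∑ i, y i = N := (Finset.mem_piAntidiag.1 hy).1
  simp [this]

/-- The second order Taylor expansion of a centered characteristic function, raised to the power
`N`: this is the analytic content of the central limit theorem for a finitely supported law. -/
lemma tendsto_sum_mul_exp_pow [Fintype ι] {p c : ι → ℝ} (hp1 : ∑ i, p i = 1)
    (hc : ∑ i, p i * c i = 0) :
    Tendsto (fun N : ℕ => (∑ i, (p i : ℂ) * Complex.exp (((c i / √N : ℝ) : ℂ) * Complex.I)) ^ N)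
      atTop (𝓝 (Complex.exp (-((∑ i, p i * c i ^ 2 : ℝ) : ℂ) / 2))) := by
  apply Complex.tendsto_pow_exp_of_isLittleO_sub_add_div
  have htaylor : (fun x : ℝ => Complex.exp ((x : ℂ) * Complex.I) - (1 + x * Complex.I - x ^ 2 / 2))
      =o[𝓝 0] fun x : ℝ => x ^ 2 := by
    have h3 : (fun x : ℝ => Complex.exp ((x : ℂ) * Complex.I) - (1 + x * Complex.I - x ^ 2 / 2))
        =O[𝓝 0] fun x : ℝ => x ^ 3 := by
      refine Asymptotics.IsBigO.of_bound 1 ?_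
      filter_upwards [Metric.ball_mem_nhds (0 : ℝ) one_pos] with x hx
      have hx1 : ‖(x : ℂ) * Complex.I‖ ≤ 1 := by
        simpa using (mem_ball_zero_iff.1 hx).le
      have hb := Complex.exp_bound hx1 (n := 3) (by norm_num)
      have hs : ∑ m ∈ Finset.range 3, ((x : ℂ) * Complex.I) ^ m / (m.factorial : ℂ) =
          1 + x * Complex.I - x ^ 2 / 2 := by
        simp [Finset.sum_range_succ, Nat.factorial, mul_pow]
        ring
      rw [hs] at hb
      refine hb.trans ?_
      rw [norm_mul, Complex.norm_I, mul_one, Complex.norm_real, norm_pow, one_mul]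
      refine mul_le_of_le_one_right (by positivity) ?_
      norm_num [Nat.factorial]
    exact h3.trans_isLittleO (Asymptotics.isLittleO_pow_pow (by norm_num))
  have hsum : (fun N : ℕ => (∑ i, (p i : ℂ) * Complex.exp (((c i / √N : ℝ) : ℂ) * Complex.I)) -
      (1 + (-((∑ i, p i * c i ^ 2 : ℝ) : ℂ) / 2) / N)) =
      fun N : ℕ => ∑ i, (p i : ℂ) * (Complex.exp (((c i / √N : ℝ) : ℂ) * Complex.I) -
        (1 + ((c i / √N : ℝ) : ℂ) * Complex.I - ((c i / √N : ℝ) : ℂ) ^ 2 / 2)) := by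
    funext N
    have h1 : ∑ i, (p i : ℂ) = 1 := by exact_mod_cast hp1
    have h2 : ∑ i, (p i : ℂ) * (((c i / √N : ℝ) : ℂ) * Complex.I) = 0 := by
      have h : ∑ i, (p i : ℂ) * (c i : ℂ) = 0 := by exact_mod_cast hc
      calc ∑ i, (p i : ℂ) * (((c i / √N : ℝ) : ℂ) * Complex.I)
          = (∑ i, (p i : ℂ) * (c i : ℂ)) * (Complex.I / (√N : ℝ)) := by
            rw [Finset.sum_mul]
            exact Finset.sum_congr rfl fun i _ => by push_cast; ring
        _ = 0 := by rw [h, zero_mul]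
    have h3 : ∑ i, (p i : ℂ) * (((c i / √N : ℝ) : ℂ) ^ 2 / 2) =
        ((∑ i, p i * c i ^ 2 : ℝ) : ℂ) / 2 / N := by
      rw [Complex.ofReal_sum, Finset.sum_div, Finset.sum_div]
      refine Finset.sum_congr rfl fun i _ => ?_
      have hsq : (c i / √N) ^ 2 = c i ^ 2 / N := by rw [div_pow, Real.sq_sqrt N.cast_nonneg]
      rw [← Complex.ofReal_pow, hsq]
      push_cast
      ring
    simp only [mul_sub, mul_add, mul_one, Finset.sum_sub_distrib, Finset.sum_add_distrib, h1, h2,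
      h3]
    ring
  rw [hsum]
  refine Asymptotics.IsLittleO.fun_sum fun i _ => Asymptotics.IsLittleO.const_mul_left ?_ _
  have hlim : Tendsto (fun N : ℕ => c i / √N) atTop (𝓝 0) :=
    tendsto_const_nhds.div_atTop (Real.tendsto_sqrt_atTop.comp tendsto_natCast_atTop_atTop)
  refine (htaylor.comp_tendsto hlim).trans_isBigO ?_
  refine Asymptotics.IsBigO.of_bound (c i ^ 2) (Eventually.of_forall fun N => ?_)
  simp only [Function.comp]
  rw [div_pow, Real.sq_sqrt N.cast_nonneg, norm_div, norm_div, norm_one, Real.norm_natCast,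
    Complex.norm_natCast, Real.norm_of_nonneg (sq_nonneg (c i))]
  exact le_of_eq (by ring)

section Covariance

variable [Fintype ι]

/-- The quadratic form of `Σ` is the variance of the coordinates under `p₀`. -/
lemma dotProduct_matSigma_mulVec [DecidableEq ι] {p₀ : ι → ℝ} (hp1 : ∑ i, p₀ i = 1) (u : ι → ℝ) :
    u ⬝ᵥ matSigma p₀ *ᵥ u = ∑ i, p₀ i * (u i - ∑ j, p₀ j * u j) ^ 2 := by
  set m := ∑ j, p₀ j * u j with hm
  have h1 : u ⬝ᵥ matSigma p₀ *ᵥ u = ∑ i, p₀ i * u i ^ 2 - m ^ 2 := by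
    rw [matSigma, sub_mulVec, dotProduct_sub, vecMulVec_mulVec]
    have h2 : p₀ ⬝ᵥ u = m := rfl
    have h3 : u ⬝ᵥ p₀ = m := by rw [dotProduct_comm]; rfl
    rw [dotProduct_smul, h2, h3]
    simp only [dotProduct, mulVec_diagonal, MulOpposite.smul_eq_mul_unop, MulOpposite.unop_op]
    congr 1
    · exact Finset.sum_congr rfl fun i _ => by ring
    · ring
  have h4 : ∀ i, p₀ i * (u i - m) ^ 2 = p₀ i * u i ^ 2 - 2 * m * (p₀ i * u i) + m ^ 2 * p₀ i :=
    fun i => by ring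
  simp only [h4, Finset.sum_add_distrib, Finset.sum_sub_distrib, ← Finset.mul_sum, hp1, ← hm]
  rw [h1]
  ring

lemma posSemidef_mul_matSigma_mul [DecidableEq ι] {p₀ : ι → ℝ} (hp : ∀ i, 0 ≤ p₀ i)
    (hp1 : ∑ i, p₀ i = 1) (B : Matrix ι ι ℝ) : (B * matSigma p₀ * Bᵀ).PosSemidef := by
  have h : (matSigma p₀).PosSemidef := by
    refine PosSemidef.of_dotProduct_mulVec_nonneg ?_ fun x => ?_
    · ext i j
      simp only [matSigma, conjTranspose_apply, Matrix.sub_apply, diagonal_apply,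
        star_trivial]
      by_cases hij : i = j
      · simp [hij]
      · simp [hij, Ne.symm hij, vecMulVec_apply, mul_comm]
    · rw [star_trivial, dotProduct_matSigma_mulVec hp1]
      exact Finset.sum_nonneg fun i _ => mul_nonneg (hp i) (sq_nonneg _)
  have h2 := h.mul_mul_conjTranspose_same B
  rwa [conjTranspose_eq_transpose_of_trivial] at h2

/-- The linear image by `B` of the scaled error of the relative frequencies. -/
noncomputable def linearError (B : Matrix ι ι ℝ) (p₀ : ι → ℝ) (N : ℕ) (y : ι → ℕ) :
    EuclideanSpace ℝ ι :=
  WithLp.toLp 2 (B *ᵥ (√N • ((fun i => (y i : ℝ) / N) - p₀)))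

lemma inner_linearError (B : Matrix ι ι ℝ) {p₀ : ι → ℝ} {N : ℕ} (hN : 0 < N) {y : ι → ℕ}
    (hy : ∑ i, y i = N) (t : EuclideanSpace ℝ ι) :
    inner ℝ (linearError B p₀ N y) t =
      ∑ i, (y i : ℝ) * (((Bᵀ *ᵥ t.ofLp) i - ∑ j, p₀ j * (Bᵀ *ᵥ t.ofLp) j) / √N) := by
  have hN' : (0 : ℝ) < N := Nat.cast_pos.2 hN
  have hs : 0 < √(N : ℝ) := Real.sqrt_pos.2 hN'
  have hss : √(N : ℝ) * √(N : ℝ) = N := Real.mul_self_sqrt hN'.le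
  set u := Bᵀ *ᵥ t.ofLp with hu
  have h1 : inner ℝ (linearError B p₀ N y) t =
      (√N • ((fun i => (y i : ℝ) / N) - p₀)) ⬝ᵥ u := by
    rw [EuclideanSpace.inner_eq_star_dotProduct, star_trivial, linearError, hu,
      dotProduct_mulVec, mulVec_transpose, dotProduct_comm]
  rw [h1]
  have hyR : ∑ i, (y i : ℝ) = N := by exact_mod_cast hy
  simp only [dotProduct, Pi.smul_apply, Pi.sub_apply, smul_eq_mul]
  have h2 : ∀ i, √(N : ℝ) * ((y i : ℝ) / N - p₀ i) * u i =
      (y i : ℝ) * (u i / √N) - √N * (p₀ i * u i) := fun i => by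
    rw [mul_sub, sub_mul]
    congr 1
    · nth_rewrite 2 [← hss]; field_simp
    · ring
  have h3 : ∀ i, (y i : ℝ) * ((u i - ∑ j, p₀ j * u j) / √N) =
      (y i : ℝ) * (u i / √N) - (y i : ℝ) * ((∑ j, p₀ j * u j) / √N) := fun i => by ring
  simp only [h2, h3, Finset.sum_sub_distrib, ← Finset.mul_sum, ← Finset.sum_mul, hyR]
  congr 1
  nth_rewrite 2 [← hss]
  field_simp

/-- The central limit theorem for linear images of the relative frequencies of a multinomial
sample, on the level of characteristic functions: by the multinomial theorem the characteristic
function is the `N`-th power of that of a single centered trial. -/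
theorem tendsto_charFun_linearError [DecidableEq ι] (B : Matrix ι ι ℝ) {p₀ : ι → ℝ}
    (hp : ∀ i, 0 ≤ p₀ i) (hp1 : ∑ i, p₀ i = 1) (t : EuclideanSpace ℝ ι) :
    Tendsto (fun N => charFun ((multinomialLaw N p₀).map (linearError B p₀ N)) t) atTop
      (𝓝 (charFun (multivariateGaussian 0 (B * matSigma p₀ * Bᵀ)) t)) := by
  set u := Bᵀ *ᵥ t.ofLp with hu
  set c : ι → ℝ := fun i => u i - ∑ j, p₀ j * u j with hc
  have hc0 : ∑ i, p₀ i * c i = 0 := by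
    simp only [hc, mul_sub, Finset.sum_sub_distrib, ← Finset.sum_mul, hp1, one_mul, sub_self]
  have hlim : charFun (multivariateGaussian 0 (B * matSigma p₀ * Bᵀ)) t =
      Complex.exp (-((∑ i, p₀ i * c i ^ 2 : ℝ) : ℂ) / 2) := by
    rw [charFun_multivariateGaussian (posSemidef_mul_matSigma_mul hp hp1 B)]
    have hq : t.ofLp ⬝ᵥ (B * matSigma p₀ * Bᵀ) *ᵥ t.ofLp = ∑ i, p₀ i * c i ^ 2 := by
      rw [← mulVec_mulVec, ← hu, ← mulVec_mulVec, dotProduct_mulVec, ← mulVec_transpose, ← hu,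
        dotProduct_matSigma_mulVec hp1]
    rw [hq, inner_zero_right]
    congr 1
    push_cast
    ring
  rw [hlim]
  refine (tendsto_sum_mul_exp_pow hp1 hc0).congr' ?_
  filter_upwards [eventually_gt_atTop 0] with N hN
  rw [charFun_apply, integral_map Measurable.of_discrete.aemeasurable (by fun_prop),
    integral_multinomialLaw N hp, Finset.sum_pow_eq_sum_piAntidiag]
  refine Finset.sum_congr rfl fun y hy => ?_
  rw [inner_linearError B hN (Finset.mem_piAntidiag.1 hy).1, likelihood]
  simp only [mul_pow, Finset.prod_mul_distrib, ← Complex.exp_nat_mul, ← Complex.exp_sum,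
    Complex.real_smul]
  push_cast
  rw [Finset.sum_mul, mul_assoc]
  congr 3
  refine Finset.sum_congr rfl fun i _ => ?_
  simp only [hc]
  push_cast
  ring

end Covariance

/-! ### From the expansion to the limit laws -/

/-- Slutsky's lemma for characteristic functions, for varying probability spaces: random vectors
whose difference tends to `0` in probability have the same limits of characteristic functions. -/
lemma tendsto_charFun_of_tendsto_measure {α E : Type*} [MeasurableSpace α]
    [NormedAddCommGroup E] [InnerProductSpace ℝ E] [MeasurableSpace E] [BorelSpace E]
    [SecondCountableTopology E] {Q : ℕ → Measure α} [∀ N, IsProbabilityMeasure (Q N)]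
    {X W : ℕ → α → E} (hX : ∀ N, Measurable (X N)) (hW : ∀ N, Measurable (W N))
    (hXW : ∀ ε > 0, Tendsto (fun N => (Q N).real {a | ε < ‖X N a - W N a‖}) atTop (𝓝 0))
    {t : E} {z : ℂ} (h : Tendsto (fun N => charFun ((Q N).map (W N)) t) atTop (𝓝 z)) :
    Tendsto (fun N => charFun ((Q N).map (X N)) t) atTop (𝓝 z) := by
  have hchar : ∀ (V : ℕ → α → E), (∀ N, Measurable (V N)) → ∀ N,
      charFun ((Q N).map (V N)) t = ∫ a, Complex.exp (inner ℝ (V N a) t * Complex.I) ∂(Q N) :=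
    fun V hV N => by
      rw [charFun_apply, integral_map (hV N).aemeasurable (by fun_prop)]
  have hint : ∀ (V : ℕ → α → E), (∀ N, Measurable (V N)) → ∀ N,
      Integrable (fun a => Complex.exp (inner ℝ (V N a) t * Complex.I)) (Q N) := fun V hV N => by
    have := hV N
    refine Integrable.of_bound (by fun_prop) 1 (ae_of_all _ fun a => ?_)
    rw [Complex.norm_exp_ofReal_mul_I]
  have hdiff : Tendsto (fun N => charFun ((Q N).map (X N)) t - charFun ((Q N).map (W N)) t)
      atTop (𝓝 0) := by
    rw [Metric.tendsto_nhds]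
    intro r hr
    set ε : ℝ := r / (4 * (‖t‖ + 1)) with hε
    have hεpos : 0 < ε := by positivity
    filter_upwards [(hXW ε hεpos).eventually_lt_const (by positivity : 0 < r / 8)] with N hN
    rw [dist_zero_right, hchar X hX, hchar W hW, ← integral_sub (hint X hX N) (hint W hW N)]
    have hmeas : MeasurableSet {a | ε < ‖X N a - W N a‖} :=
      measurableSet_lt measurable_const ((hX N).sub (hW N)).norm
    have hpt : ∀ a, ‖Complex.exp (inner ℝ (X N a) t * Complex.I) -
        Complex.exp (inner ℝ (W N a) t * Complex.I)‖ ≤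
        ε * ‖t‖ + {a | ε < ‖X N a - W N a‖}.indicator (fun _ => (2 : ℝ)) a := fun a => by
      by_cases ha : ε < ‖X N a - W N a‖
      · rw [Set.indicator_of_mem (show a ∈ {a | ε < ‖X N a - W N a‖} from ha)]
        refine (norm_sub_le _ _).trans ?_
        rw [Complex.norm_exp_ofReal_mul_I, Complex.norm_exp_ofReal_mul_I]
        nlinarith [norm_nonneg t]
      · rw [Set.indicator_of_notMem (show a ∉ {a | ε < ‖X N a - W N a‖} from ha), add_zero]
        have hfac : Complex.exp (inner ℝ (X N a) t * Complex.I) -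
            Complex.exp (inner ℝ (W N a) t * Complex.I) =
            Complex.exp (inner ℝ (W N a) t * Complex.I) *
              (Complex.exp (Complex.I * (inner ℝ (X N a - W N a) t : ℝ)) - 1) := by
          rw [mul_sub, ← Complex.exp_add, mul_one, inner_sub_left]
          congr 2
          push_cast
          ring
        rw [hfac, norm_mul, Complex.norm_exp_ofReal_mul_I, one_mul]
        refine Real.norm_exp_I_mul_ofReal_sub_one_le.trans ((norm_inner_le_norm _ _).trans ?_)
        exact mul_le_mul_of_nonneg_right (not_lt.1 ha) (norm_nonneg _)
    have hi : Integrable ({a | ε < ‖X N a - W N a‖}.indicator (fun _ => (2 : ℝ))) (Q N) :=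
      (integrable_const _).indicator hmeas
    calc ‖∫ a, (Complex.exp (inner ℝ (X N a) t * Complex.I) -
          Complex.exp (inner ℝ (W N a) t * Complex.I)) ∂(Q N)‖
        ≤ ∫ a, (ε * ‖t‖ + {a | ε < ‖X N a - W N a‖}.indicator (fun _ => (2 : ℝ)) a) ∂(Q N) :=
          norm_integral_le_of_norm_le ((integrable_const _).add hi) (ae_of_all _ hpt)
      _ = ε * ‖t‖ + 2 * (Q N).real {a | ε < ‖X N a - W N a‖} := by
          rw [integral_add (integrable_const _) hi, integral_indicator_const _ hmeas,
            integral_const, probReal_univ, one_smul, smul_eq_mul, mul_comm 2]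
      _ < r := by
          have h1 : ε * ‖t‖ ≤ r / 4 := by
            rw [hε, div_mul_eq_mul_div, div_le_div_iff₀ (by positivity) (by norm_num)]
            nlinarith [norm_nonneg t]
          linarith
  simpa using hdiff.add h

/-- Conditioning on events whose probability tends to `1` does not change limits of integrals of
bounded functions. -/
lemma tendsto_integral_cond {α : Type*} [MeasurableSpace α] {Q : ℕ → Measure α}
    [∀ N, IsProbabilityMeasure (Q N)] {S : Set α} (hS : MeasurableSet S)
    (hS0 : Tendsto (fun N => (Q N).real Sᶜ) atTop (𝓝 0)) {f g : ℕ → α → ℝ} {b : ℝ}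
    (hg : ∀ N, Measurable (g N)) (hb : ∀ N a, |g N a| ≤ b)
    (hfg : ∀ N, ∀ a ∈ S, f N a = g N a) {z : ℝ}
    (h : Tendsto (fun N => ∫ a, g N a ∂(Q N)) atTop (𝓝 z)) :
    Tendsto (fun N => ∫ a, f N a ∂((Q N)[|S])) atTop (𝓝 z) := by
  have hint : ∀ N, Integrable (g N) (Q N) := fun N =>
    Integrable.of_bound (hg N).aestronglyMeasurable b (ae_of_all _ (hb N))
  have hcompl : Tendsto (fun N => ∫ a in Sᶜ, g N a ∂(Q N)) atTop (𝓝 0) := by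
    refine squeeze_zero_norm (fun N => ?_) (by simpa using hS0.const_mul b)
    exact norm_setIntegral_le_of_norm_le_const (measure_lt_top _ _) fun a _ => hb N a
  have hSI : Tendsto (fun N => ∫ a in S, g N a ∂(Q N)) atTop (𝓝 z) := by
    have h1 := h.sub hcompl
    rw [sub_zero] at h1
    refine h1.congr fun N => ?_
    rw [← integral_add_compl hS (hint N), add_sub_cancel_right]
  have hS1 : Tendsto (fun N => (Q N).real S) atTop (𝓝 1) := by
    have h1 := hS0.const_sub 1
    rw [sub_zero] at h1
    refine h1.congr fun N => ?_
    rw [probReal_compl_eq_one_sub hS, sub_sub_cancel]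
  have h2 := (hS1.inv₀ one_ne_zero).mul hSI
  rw [inv_one, one_mul] at h2
  refine h2.congr fun N => ?_
  rw [ProbabilityTheory.cond, integral_smul_measure, ENNReal.toReal_inv, smul_eq_mul,
    setIntegral_congr_fun hS (hfg N)]
  rfl

lemma exists_norm_toLp_le (ι : Type*) [Fintype ι] :
    ∃ C, 0 ≤ C ∧ ∀ v : ι → ℝ, ‖(WithLp.toLp 2 v : EuclideanSpace ℝ ι)‖ ≤ C * ‖v‖ :=
  ⟨_, norm_nonneg _,
    ((EuclideanSpace.equiv ι ℝ).symm : (ι → ℝ) →L[ℝ] EuclideanSpace ℝ ι).le_opNorm⟩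

lemma norm_le_norm_toLp [Fintype ι] (v : ι → ℝ) :
    ‖v‖ ≤ ‖(WithLp.toLp 2 v : EuclideanSpace ℝ ι)‖ :=
  (pi_norm_le_iff_of_nonneg (norm_nonneg _)).2 fun i =>
    PiLp.norm_apply_le (WithLp.toLp 2 v : EuclideanSpace ℝ ι) i

lemma isMLE_mle [Fintype ι] [Fintype κ] {A : Matrix κ ι ℝ} {y : ι → ℕ} (h : y ∈ mleExists A) :
    IsMLE A y (mle A y) := by
  have h' : ∃ p, IsMLE A y p := h
  rw [mle, dif_pos h']
  exact h'.choose_spec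

lemma augmentedMLE_of_mem [Fintype ι] [Fintype κ] {A : Matrix κ ι ℝ} {y : ι → ℕ}
    (h : y ∈ mleExists A) :
    augmentedMLE A y = mle A y := if_pos h

section Limit

variable [Fintype ι] [DecidableEq ι] [Fintype κ] [Fintype τ] [DecidableEq τ]

/-- As long as the scaled error of the relative frequencies stays bounded, the MLE eventually
exists and its scaled error is uniformly close to the image by `M` of that of the frequencies. -/
lemma eventually_norm_scaledError_sub_le {A : Matrix κ ι ℝ} (hA : IsDesignMatrix A)
    {D : Matrix τ ι ℝ} (hD : IsKernelBasisMatrix A D) {p₀ : ι → ℝ} (hp₀ : p₀ ∈ model A) (r : ℝ)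
    {ε : ℝ} (hε : 0 < ε) :
    ∀ᶠ N : ℕ in atTop, ∀ y : ι → ℕ, ∑ i, y i = N → ‖linearError 1 p₀ N y‖ ≤ r →
      y ∈ mleExists A ∧
        ∀ p, IsMLE A y p → ‖scaledError N p₀ p - linearError (matM p₀ D) p₀ N y‖ ≤ ε := by
  obtain ⟨C, δ, hC, hδ, H⟩ := exists_norm_mle_sub_le hA hD hp₀
  obtain ⟨E, hE0, hE⟩ := exists_norm_toLp_le ι
  have hsqrt : Tendsto (fun N : ℕ => √(N : ℝ)) atTop atTop :=
    Real.tendsto_sqrt_atTop.comp tendsto_natCast_atTop_atTop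
  have h1 : Tendsto (fun N : ℕ => r / √(N : ℝ)) atTop (𝓝 0) :=
    tendsto_const_nhds.div_atTop hsqrt
  have h2 : Tendsto (fun N : ℕ => E * (C * r ^ 2) / √(N : ℝ)) atTop (𝓝 0) :=
    tendsto_const_nhds.div_atTop hsqrt
  filter_upwards [h1.eventually_lt_const hδ, h2.eventually_lt_const hε, eventually_gt_atTop 0]
    with N hN1 hN2 hN y hy hr
  have hs : 0 < √(N : ℝ) := Real.sqrt_pos.2 (Nat.cast_pos.2 hN)
  set q : ι → ℝ := fun i => (y i : ℝ) / N with hq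
  have hqr : ‖q - p₀‖ ≤ r / √N := by
    rw [le_div_iff₀ hs]
    have h := (norm_le_norm_toLp _).trans hr
    rwa [one_mulVec, norm_smul, Real.norm_of_nonneg hs.le, mul_comm] at h
  obtain ⟨hex, hexp⟩ := H N y q hN hy hq (hqr.trans hN1.le)
  refine ⟨hex, fun p hp => le_trans ?_ hN2.le⟩
  have he : scaledError N p₀ p - linearError (matM p₀ D) p₀ N y =
      √(N : ℝ) • WithLp.toLp 2 (p - p₀ - matM p₀ D *ᵥ (q - p₀)) := by
    rw [scaledError, linearError, mulVec_smul, ← WithLp.toLp_sub, ← smul_sub, WithLp.toLp_smul]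
  rw [he, norm_smul, Real.norm_of_nonneg hs.le]
  have hsq : ‖q - p₀‖ ^ 2 ≤ (r / √N) ^ 2 := pow_le_pow_left₀ (norm_nonneg _) hqr 2
  calc √(N : ℝ) * ‖WithLp.toLp 2 (p - p₀ - matM p₀ D *ᵥ (q - p₀))‖
      ≤ √(N : ℝ) * (E * (C * (r / √N) ^ 2)) :=
        mul_le_mul_of_nonneg_left ((hE _).trans (mul_le_mul_of_nonneg_left
          ((hexp p hp).trans (mul_le_mul_of_nonneg_left hsq hC)) hE0)) hs.le
    _ = E * (C * r ^ 2) / √N := by field_simp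

/-- The probability that the MLE does not exist, or that its scaled error deviates from the linear
term by more than `ε`, tends to `0`: the scaled errors of the frequencies are tight. -/
lemma tendsto_measureReal_bad {A : Matrix κ ι ℝ} (hA : IsDesignMatrix A)
    {D : Matrix τ ι ℝ} (hD : IsKernelBasisMatrix A D) {p₀ : ι → ℝ} (hp₀ : p₀ ∈ model A)
    {ε : ℝ} (hε : 0 < ε) :
    Tendsto (fun N => (multinomialLaw N p₀).real {y | ¬ (y ∈ mleExists A ∧
        ∀ p, IsMLE A y p → ‖scaledError N p₀ p - linearError (matM p₀ D) p₀ N y‖ ≤ ε)})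
      atTop (𝓝 0) := by
  have hpos : ∀ i, 0 ≤ p₀ i := fun i => (hp₀.1 i).le
  have hprob : ∀ N, IsProbabilityMeasure (multinomialLaw N p₀) := fun N =>
    isProbabilityMeasure_multinomialLaw N hpos hp₀.2.1
  have hprob' : ∀ N, IsProbabilityMeasure ((multinomialLaw N p₀).map (linearError 1 p₀ N)) :=
    fun N => Measure.isProbabilityMeasure_map Measurable.of_discrete.aemeasurable
  have htight := isTightMeasureSet_of_tendsto_charFun
    (μ := fun N => (multinomialLaw N p₀).map (linearError 1 p₀ N))
    (f := charFun (multivariateGaussian 0 (1 * matSigma p₀ * 1ᵀ)))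
    (continuous_charFun.continuousAt) (tendsto_charFun_linearError 1 hpos hp₀.2.1)
  have htail := tendsto_measure_norm_gt_of_isTightMeasureSet htight
  rw [Metric.tendsto_nhds]
  intro η hη
  obtain ⟨r, hr⟩ := (htail.eventually_lt_const (ENNReal.ofReal_pos.2 hη)).exists
  filter_upwards [eventually_norm_scaledError_sub_le hA hD hp₀ r hε] with N hN
  rw [dist_zero_right, Real.norm_of_nonneg measureReal_nonneg]
  refine (ENNReal.toReal_lt_of_lt_ofReal (lt_of_le_of_lt ?_ hr))
  have h1 : ((multinomialLaw N p₀).map (linearError 1 p₀ N)) {x | r < ‖x‖} ≤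
      ⨆ μ ∈ Set.range fun N => (multinomialLaw N p₀).map (linearError 1 p₀ N), μ {x | r < ‖x‖} :=
    le_iSup₂_of_le _ ⟨N, rfl⟩ le_rfl
  refine le_trans ?_ h1
  rw [Measure.map_apply Measurable.of_discrete (measurableSet_lt measurable_const measurable_norm)]
  refine measure_mono_ae ?_
  filter_upwards [ae_multinomialLaw_sum_eq N p₀] with y hy hbad
  exact not_le.1 fun hle => hbad (hN y hy hle)

lemma tendsto_measureReal_compl_mleExists {A : Matrix κ ι ℝ} (hA : IsDesignMatrix A)
    {D : Matrix τ ι ℝ} (hD : IsKernelBasisMatrix A D) {p₀ : ι → ℝ} (hp₀ : p₀ ∈ model A) :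
    Tendsto (fun N => (multinomialLaw N p₀).real (mleExists A)ᶜ) atTop (𝓝 0) := by
  have hprob : ∀ N, IsProbabilityMeasure (multinomialLaw N p₀) := fun N =>
    isProbabilityMeasure_multinomialLaw N (fun i => (hp₀.1 i).le) hp₀.2.1
  refine squeeze_zero (fun _ => measureReal_nonneg) (fun N => ?_)
    (tendsto_measureReal_bad hA hD hp₀ one_pos)
  exact measureReal_mono fun y hy hgood => hy hgood.1

/-- The law of the scaled error of the augmented MLE converges weakly to the limit law. -/
lemma tendsto_map_augmentedMLE {A : Matrix κ ι ℝ} (hA : IsDesignMatrix A)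
    {D : Matrix τ ι ℝ} (hD : IsKernelBasisMatrix A D) {p₀ : ι → ℝ} (hp₀ : p₀ ∈ model A)
    {Q : ℕ → ProbabilityMeasure (EuclideanSpace ℝ ι)}
    (hQ : ∀ N, (Q N : Measure (EuclideanSpace ℝ ι)) =
      (multinomialLaw N p₀).map fun y => scaledError N p₀ (augmentedMLE A y)) :
    Tendsto Q atTop (𝓝 ⟨limitLaw p₀ D, inferInstance⟩) := by
  have hpos : ∀ i, 0 ≤ p₀ i := fun i => (hp₀.1 i).le
  have hprob : ∀ N, IsProbabilityMeasure (multinomialLaw N p₀) := fun N =>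
    isProbabilityMeasure_multinomialLaw N hpos hp₀.2.1
  refine ProbabilityMeasure.tendsto_of_tendsto_charFun fun t => ?_
  simp only [hQ]
  refine tendsto_charFun_of_tendsto_measure (fun N => Measurable.of_discrete)
    (fun N => Measurable.of_discrete) (fun ε hε => ?_)
    (tendsto_charFun_linearError (matM p₀ D) hpos hp₀.2.1 t)
  refine squeeze_zero (fun _ => measureReal_nonneg) (fun N => ?_)
    (tendsto_measureReal_bad hA hD hp₀ hε)
  refine measureReal_mono fun y hy hgood => ?_
  have h := hgood.2 _ (isMLE_mle hgood.1)
  rw [← augmentedMLE_of_mem hgood.1] at h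
  exact absurd h (not_le.2 hy)

end Limit

lemma map_cond_comp {Ω α E : Type*} [MeasurableSpace Ω] [MeasurableSpace α] [MeasurableSpace E]
    {P : Measure Ω} {μ : Measure α} {Y : Ω → α} (hY : HasLaw Y μ P) {S : Set α}
    (hS : MeasurableSet S) {g : α → E} (hg : Measurable g) :
    (P[|Y ⁻¹' S]).map (fun ω => g (Y ω)) = (μ[|S]).map g := by
  have hYr : AEMeasurable Y (P.restrict (Y ⁻¹' S)) :=
    hY.aemeasurable.mono_measure Measure.restrict_le_self
  rw [ProbabilityTheory.cond, ProbabilityTheory.cond, Measure.map_smul, Measure.map_smul,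
    ← Function.comp_def, ← AEMeasurable.map_map_of_aemeasurable hg.aemeasurable hYr,
    ← Measure.restrict_map_of_aemeasurable hY.aemeasurable hS, hY.map_eq, ← hY.map_eq,
    Measure.map_apply_of_aemeasurable hY.aemeasurable hS]

end RelationalModel

theorem mainTheorem2 {ι κ τ : Type*} [Fintype ι] [DecidableEq ι] [Fintype κ]
    [Fintype τ] [DecidableEq τ]
    (A : Matrix κ ι ℝ) (hA : RelationalModel.IsDesignMatrix A)
    (D : Matrix τ ι ℝ) (hD : RelationalModel.IsKernelBasisMatrix A D)
    (p₀ : ι → ℝ) (hp₀ : p₀ ∈ RelationalModel.model A)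
    {Ω : ℕ → Type*} [∀ N, MeasurableSpace (Ω N)]
    (P : ∀ N, Measure (Ω N)) [∀ N, IsProbabilityMeasure (P N)]
    (Y : ∀ N, Ω N → ι → ℕ)
    (hY : ∀ N, HasLaw (Y N) (RelationalModel.multinomialLaw N p₀) (P N)) :
    IsUnit (RelationalModel.matGram p₀ D) ∧
    RelationalModel.TendstoInLawCond P
      (fun N ω => RelationalModel.scaledError N p₀ (RelationalModel.mle A (Y N ω)))
      (fun N => {ω | Y N ω ∈ RelationalModel.mleExists A})
      (RelationalModel.limitLaw p₀ D) ∧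
    TendstoInDistribution
      (fun N ω => RelationalModel.scaledError N p₀ (RelationalModel.augmentedMLE A (Y N ω)))
      atTop id P (RelationalModel.limitLaw p₀ D) := by
  have hprob : ∀ N, IsProbabilityMeasure (RelationalModel.multinomialLaw N p₀) := fun N =>
    RelationalModel.isProbabilityMeasure_multinomialLaw N (fun i => (hp₀.1 i).le) hp₀.2.1
  have hS : MeasurableSet (RelationalModel.mleExists A) := MeasurableSet.of_discrete
  have hS0 := RelationalModel.tendsto_measureReal_compl_mleExists hA hD hp₀
  have haem : ∀ N (g : (ι → ℕ) → EuclideanSpace ℝ ι), AEMeasurable (fun ω => g (Y N ω)) (P N) :=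
    fun N g => (Measurable.of_discrete (f := g)).comp_aemeasurable (hY N).aemeasurable
  have hmap : ∀ N (g : (ι → ℕ) → EuclideanSpace ℝ ι),
      (P N).map (fun ω => g (Y N ω)) = (RelationalModel.multinomialLaw N p₀).map g := fun N g => by
    rw [← (hY N).map_eq, AEMeasurable.map_map_of_aemeasurable
      Measurable.of_discrete.aemeasurable (hY N).aemeasurable]
    rfl
  refine ⟨RelationalModel.isUnit_matGram hA hD hp₀, ⟨fun N => ?_, ?_, ?_⟩, ⟨fun N => haem N fun y =>
    RelationalModel.scaledError N p₀ (RelationalModel.augmentedMLE A y), aemeasurable_id, ?_⟩⟩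
  · exact (haem N fun y => RelationalModel.scaledError N p₀ (RelationalModel.mle A y)).mono_ac
      cond_absolutelyContinuous
  · filter_upwards [hS0.eventually_lt_const one_pos] with N hN
    have h1 : P N {ω | Y N ω ∈ RelationalModel.mleExists A} =
        RelationalModel.multinomialLaw N p₀ (RelationalModel.mleExists A) := by
      rw [← (hY N).map_eq, Measure.map_apply_of_aemeasurable (hY N).aemeasurable hS]
      rfl
    rw [h1, pos_iff_ne_zero]
    intro h0
    rw [probReal_compl_eq_one_sub hS, measureReal_def, h0] at hN
    simp at hN
  · refine FiniteMeasure.tendsto_iff_forall_integral_tendsto.2 fun f => ?_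
    have hlaw := RelationalModel.tendsto_map_augmentedMLE hA hD hp₀ (Q := fun N =>
      ⟨(RelationalModel.multinomialLaw N p₀).map fun y =>
        RelationalModel.scaledError N p₀ (RelationalModel.augmentedMLE A y),
        Measure.isProbabilityMeasure_map Measurable.of_discrete.aemeasurable⟩) fun N => rfl
    have hint := ProbabilityMeasure.tendsto_iff_forall_integral_tendsto.1 hlaw f
    have hcond := RelationalModel.tendsto_integral_cond (b := ‖f‖)
      (f := fun N y => f (RelationalModel.scaledError N p₀ (RelationalModel.mle A y)))
      (g := fun N y => f (RelationalModel.scaledError N p₀ (RelationalModel.augmentedMLE A y)))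
      hS hS0 (fun N => Measurable.of_discrete) (fun N y => f.norm_coe_le_norm _)
      (fun N y hy => by rw [RelationalModel.augmentedMLE_of_mem hy])
      (hint.congr fun N => integral_map Measurable.of_discrete.aemeasurable
        f.continuous.aestronglyMeasurable)
    refine hcond.congr fun N => ?_
    have hc := RelationalModel.map_cond_comp (hY N) hS
      (g := fun y => RelationalModel.scaledError N p₀ (RelationalModel.mle A y))
      Measurable.of_discrete
    rw [← integral_map (φ := fun y => RelationalModel.scaledError N p₀ (RelationalModel.mle A y))
      Measurable.of_discrete.aemeasurable f.continuous.aestronglyMeasurable, ← hc]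
    rfl
  · have hlaw := RelationalModel.tendsto_map_augmentedMLE hA hD hp₀ (Q := fun N =>
      ⟨(P N).map fun ω => RelationalModel.scaledError N p₀ (RelationalModel.augmentedMLE A (Y N ω)),
        Measure.isProbabilityMeasure_map (haem N fun y =>
          RelationalModel.scaledError N p₀ (RelationalModel.augmentedMLE A y))⟩) fun N =>
        hmap N fun y => RelationalModel.scaledError N p₀ (RelationalModel.augmentedMLE A y)
    have hid : (⟨(RelationalModel.limitLaw p₀ D).map id,
        Measure.isProbabilityMeasure_map aemeasurable_id⟩ :
          ProbabilityMeasure (EuclideanSpace ℝ ι)) =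
        ⟨RelationalModel.limitLaw p₀ D, inferInstance⟩ :=
      Subtype.ext Measure.map_id
    rw [hid]
    exact hlaw
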